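/- **Trapezoid comparison theorem.** Let $X$ be a complete Alexandrov space of non-negative curvature, i.e. a complete metric space in which any two points are joined by a geodesic (a unit-speed length-minimizing path) and every geodesic triangle is at least as fat as its Euclidean comparison triangle: the distance from a vertex to a point of the opposite side is at least the corresponding distance in the comparison triangle. For curves $\gamma,\eta$ issuing from $x$ at time $0$, let $\measuredangle_x(\gamma'(0),\eta'(0))$ denote the angle between their initial directions, i.e. the limit (in general, the upper limit) as $t,u\downarrow 0$ of the Euclidean comparison angle at $x$ of the triple $(x,\gamma(t),\eta(u))$. A curve $\varphi$ defined on an interval $I\subseteq\mathbb R$ is a unit-speed quasi-geodesic if at every $t\in I$ its metric speed $\lim_{u\to t,\,u\in I} d(\varphi(t),\varphi(u))/|t-u|$ is $1$ and, for every $x\in X$, the function $t\mapsto d(x,\varphi(t))^2-t^2$ is concave on $I$. Let $\hat p,q_1,q_2\in X$ and let $l,s,r>0$. Let $\varphi_1:[0,l]\to X$ be a geodesic from $\hat p$ to $q_1$, so that $l=d(\hat p,q_1)$. Let $\varphi_3:I\to X$ be a unit-speed quasi-geodesic with $\varphi_3(0)=\hat p$, where the interval $I$ contains $0$ and some positive number.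 Let $0<\beta\le\frac{\pi}{2}$ and let $\varphi_2:[0,\frac{s}{\sin\beta}]\to X$ be a geodesic from $\hat p$ to $q_2$, so that $d(\hat p,q_2)=\frac{s}{\sin\beta}$. Suppose that the initial directions are coplanar in the sense that $$\measuredangle_{\hat p}(\varphi_2'(0),\varphi_1'(0))=\alpha_2,\quad \measuredangle_{\hat p}(\varphi_1'(0),\varphi_3'(0))=\alpha_3,\quad \measuredangle_{\hat p}(\varphi_2'(0),\varphi_3'(0))=\beta,\quad \alpha_2+\alpha_3=\beta,$$ and that $l\cos\alpha_3\in I$. Let $\sigma_s:[0,r]\to X$ be a geodesic from $q_2$ to $q_1$ such that $$\measuredangle_{q_2}\Big(\sigma_s'(0),\tfrac{d^-\varphi_2}{dt}\big(\tfrac{s}{\sin\beta}\big)\Big)\le\pi-\beta,$$ where the left derivative $\frac{d^-\varphi_2}{dt}(\frac{s}{\sin\beta})$ is the initial direction at $q_2$ of the reversed curve $t\mapsto\varphi_2(\frac{s}{\sin\beta}-t)$. Then $$d(\sigma_s(r),\varphi_3(I))\le d(\sigma_s(r),\varphi_3(l\cos\alpha_3))\le s.$$ -/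

import Mathlib

open Real Set Filter Topology

/-- `γ` restricted to `[0, L]` is a unit-speed length-minimizing path (a geodesic) from `p` to `q`;
in particular `L = dist p q`. Values of `γ` outside `[0, L]` are irrelevant. -/
def IsGeodesicSegment {X : Type*} [MetricSpace X] (γ : ℝ → X) (L : ℝ) (p q : X) : Prop :=
  0 ≤ L ∧ γ 0 = p ∧ γ L = q ∧
    ∀ t ∈ Icc (0 : ℝ) L, ∀ u ∈ Icc (0 : ℝ) L, dist (γ t) (γ u) = |t - u|

/-- A metric space in which any two points are joined by a geodesic and in which every geodesic
triangle is at least as fat as its Euclidean comparison triangle: if `w` lies on a side `[y z]` of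
a triangle `x y z`, and `x' y' z' w'` is the corresponding configuration in the Euclidean plane
(so `w'` is the point of the segment `[y' z']` corresponding to `w`), then
`dist x' w' ≤ dist x w`. In a geodesic space, `w` lies on some geodesic from `y` to `z`
exactly when `dist y w + dist w z = dist y z`. -/
structure IsNonnegativelyCurved (X : Type*) [MetricSpace X] : Prop where
  exists_geodesic : ∀ p q : X, ∃ γ : ℝ → X, IsGeodesicSegment γ (dist p q) p q
  triangle_comparison : ∀ x y z w : X, dist y w + dist w z = dist y z →
    ∀ x' y' z' w' : EuclideanSpace ℝ (Fin 2),
      dist x' y' = dist x y → dist y' z' = dist y z → dist x' z' = dist x z →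
      dist y' w' = dist y w → dist w' z' = dist w z →
      dist x' w' ≤ dist x w

/-- The angle at the vertex corresponding to `p` of the Euclidean comparison triangle of
`p, x, y`, given by the law of cosines (meaningful for `x ≠ p` and `y ≠ p`). -/
noncomputable def comparisonAngle {X : Type*} [MetricSpace X] (p x y : X) : ℝ :=
  arccos ((dist p x ^ 2 + dist p y ^ 2 - dist x y ^ 2) / (2 * dist p x * dist p y))

/-- The angle at `p` between the initial directions of two curves `γ`, `η` issuing from `p` at
time `0`: the limit of the comparison angles of `p, γ t, η u` as `t, u` decrease to `0`.
It is written as an upper limit, which always makes sense because comparison angles lie in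
`[0, π]`; for geodesics and quasi-geodesics in nonnegatively curved Alexandrov spaces the limit
exists. -/
noncomputable def initialAngle {X : Type*} [MetricSpace X] (p : X) (γ η : ℝ → X) : ℝ :=
  limsup (fun tu : ℝ × ℝ => comparisonAngle p (γ tu.1) (η tu.2))
    (𝓝[>] (0 : ℝ) ×ˢ 𝓝[>] (0 : ℝ))

/-- `φ` is a unit-speed quasi-geodesic on the interval `I` in a nonnegatively curved space:
its metric speed (one-sided at endpoints of `I`) is `1`, and for every point `x` the function
`t ↦ dist x (φ t) ^ 2 / 2` has second derivative at most `1` along `φ` in the barrier sense, that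
is, `t ↦ dist x (φ t) ^ 2 - t ^ 2` is concave. Concavity on `I` includes that `I` is an
interval. -/
structure IsQuasiGeodesicOn {X : Type*} [MetricSpace X] (φ : ℝ → X) (I : Set ℝ) : Prop where
  unit_speed : ∀ t ∈ I, Tendsto (fun u => dist (φ t) (φ u) / |t - u|) (𝓝[I \ {t}] t) (𝓝 1)
  concave : ∀ x : X, ConcaveOn ℝ I (fun t => dist x (φ t) ^ 2 - t ^ 2)

/-! Everything reduces to two planar facts about `q₁ = σ r`. Hinge comparison along the
quasi-geodesic (`IsQuasiGeodesicOn.dist_sq_le`) bounds `dist q₁ (φ₃ T) ^ 2` by `T ^ 2 + l ^ 2 - 2 *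
l * T * cos α₃`; the minimizing `T = l * cos α₃` gives distance at most `l * sin α₃`. In the
comparison triangle of `p, q₂, q₁`, the angle `A` at `p` is at most `α₂` and the angle `B` at `q₂`
at most `π - β` (`comparisonAngle_le_initialAngle`). The bound on `B` keeps `q₁` no higher than `q₂`
over the line at angle `β` to the side `p q₂` (`mul_sin_sub_le`): `l * sin (β - A) ≤ s`. Coplanarity
gives `α₃ = β - α₂ ≤ β - A`, which joins the two estimates. -/

theorem cos_comparisonAngle_mul {X : Type*} [MetricSpace X] {p x y : X} (hx : x ≠ p) (hy : y ≠ p) :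
    2 * dist p x * dist p y * cos (comparisonAngle p x y) =
      dist p x ^ 2 + dist p y ^ 2 - dist x y ^ 2 := by
  have h1 : 0 < dist p x := dist_pos.2 hx.symm
  have h2 : 0 < dist p y := dist_pos.2 hy.symm
  have t1 := dist_triangle p x y
  have t2 := dist_triangle x p y
  have t3 := dist_triangle_right p x y
  rw [dist_comm x p] at t2
  have h3 := mul_pos h1 h2
  have h4 : 0 ≤ dist x y := dist_nonneg
  -- The triangle inequalities keep the quotient in `[-1, 1]`, where `arccos` does not clamp.
  rw [comparisonAngle, cos_arccos]
  · field_simp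
  · rw [le_div_iff₀ (by positivity)]
    nlinarith
  · rw [div_le_iff₀ (by positivity)]
    have t4 : |dist p x - dist p y| ≤ dist x y := by
      rw [abs_le]
      constructor <;> linarith
    have := sq_abs (dist p x - dist p y)
    nlinarith [abs_nonneg (dist p x - dist p y)]

theorem comparisonAngle_comm {X : Type*} [MetricSpace X] (p x y : X) :
    comparisonAngle p x y = comparisonAngle p y x := by
  unfold comparisonAngle
  rw [dist_comm x y]
  congr 1
  ring

theorem comparisonAngle_nonneg {X : Type*} [MetricSpace X] (p x y : X) :
    0 ≤ comparisonAngle p x y := arccos_nonneg _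

theorem comparisonAngle_le_pi {X : Type*} [MetricSpace X] (p x y : X) :
    comparisonAngle p x y ≤ π := arccos_le_pi _

/-- The quantitative form of triangle comparison obtained from Stewart's theorem. -/
theorem IsNonnegativelyCurved.stewart {X : Type*} [MetricSpace X] (hX : IsNonnegativelyCurved X)
    {x y z w : X} (hw : dist y w + dist w z = dist y z) (hxy : x ≠ y) (hyz : y ≠ z) :
    dist w z * dist x y ^ 2 + dist y w * dist x z ^ 2 - dist y w * dist w z * dist y z ≤
      dist y z * dist x w ^ 2 := by
  have hb : 0 < dist y x := dist_pos.2 hxy.symm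
  have hc : 0 < dist y z := dist_pos.2 hyz
  have hcos := cos_comparisonAngle_mul hxy hyz.symm
  set A := comparisonAngle y x z
  set b := dist y x
  set c := dist y z
  have hA := sin_sq_add_cos_sq A
  have ht : 0 ≤ dist y w := dist_nonneg
  have hu : 0 ≤ dist w z := dist_nonneg
  set t := dist y w
  -- Planar model: `y` at the origin, `z` and `w` on the first axis, `x` in polar coordinates.
  have key := hX.triangle_comparison x y z w hw !₂[b * cos A, b * sin A] !₂[0, 0] !₂[c, 0] !₂[t, 0]
    (by
      rw [EuclideanSpace.dist_eq, dist_comm x y, sqrt_eq_iff_eq_sq (by positivity) (by positivity)]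
      simp only [Fin.sum_univ_two, Real.dist_eq, sq_abs]
      simp only [Matrix.cons_val_zero, Matrix.cons_val_one]
      change _ = b ^ 2
      linear_combination b ^ 2 * hA)
    (by
      rw [EuclideanSpace.dist_eq, sqrt_eq_iff_eq_sq (by positivity) (by positivity)]
      simp [Fin.sum_univ_two, Real.dist_eq, sq_abs, c])
    (by
      rw [EuclideanSpace.dist_eq, sqrt_eq_iff_eq_sq (by positivity) (by positivity)]
      simp only [Fin.sum_univ_two, Real.dist_eq, sq_abs]
      simp only [Matrix.cons_val_zero, Matrix.cons_val_one]
      linear_combination b ^ 2 * hA - hcos)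
    (by
      rw [EuclideanSpace.dist_eq, sqrt_eq_iff_eq_sq (by positivity) (by positivity)]
      simp [Fin.sum_univ_two, Real.dist_eq, sq_abs, t])
    (by
      rw [EuclideanSpace.dist_eq, sqrt_eq_iff_eq_sq (by positivity) (by positivity)]
      simp only [Fin.sum_univ_two, Real.dist_eq, sq_abs]
      simp only [Matrix.cons_val_zero, Matrix.cons_val_one]
      rw [show dist w z = c - t by linarith]
      ring)
  rw [EuclideanSpace.dist_eq, sqrt_le_left dist_nonneg] at key
  simp only [Fin.sum_univ_two, Real.dist_eq, sq_abs] at key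
  simp only [Matrix.cons_val_zero, Matrix.cons_val_one] at key
  have h := mul_le_mul_of_nonneg_left key hc.le
  rw [dist_comm x y, show dist w z = c - t by linarith]
  change (c - t) * b ^ 2 + _ - _ ≤ _
  linear_combination h + t * hcos - c * b ^ 2 * hA

/-! ### Angle monotonicity along geodesics -/

theorem IsGeodesicSegment.dist_left {X : Type*} [MetricSpace X] {γ : ℝ → X} {L : ℝ} {p q : X}
    (h : IsGeodesicSegment γ L p q) {t : ℝ} (ht : t ∈ Icc 0 L) : dist p (γ t) = t := by
  have := h.2.2.2 0 ⟨le_rfl, h.1⟩ t ht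
  rwa [h.2.1, zero_sub, abs_neg, abs_of_nonneg ht.1] at this

theorem IsGeodesicSegment.dist_right {X : Type*} [MetricSpace X] {γ : ℝ → X} {L : ℝ} {p q : X}
    (h : IsGeodesicSegment γ L p q) {t : ℝ} (ht : t ∈ Icc 0 L) : dist (γ t) q = L - t := by
  have := h.2.2.2 t ht L ⟨h.1, le_rfl⟩
  rwa [h.2.2.1, abs_sub_comm, abs_of_nonneg (sub_nonneg.2 ht.2)] at this

theorem IsGeodesicSegment.dist_endpoints {X : Type*} [MetricSpace X] {γ : ℝ → X} {L : ℝ} {p q : X}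
    (h : IsGeodesicSegment γ L p q) : dist p q = L := by
  simpa [h.2.2.1] using h.dist_left (right_mem_Icc.2 h.1)

theorem IsGeodesicSegment.reverse {X : Type*} [MetricSpace X] {γ : ℝ → X} {L : ℝ} {p q : X}
    (h : IsGeodesicSegment γ L p q) : IsGeodesicSegment (fun t => γ (L - t)) L q p := by
  refine ⟨h.1, by simpa using h.2.2.1, by simpa using h.2.1, fun t ht u hu => ?_⟩
  rw [h.2.2.2 _ ⟨by linarith [ht.2], by linarith [ht.1]⟩ _ ⟨by linarith [hu.2], by linarith [hu.1]⟩,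
    abs_sub_comm]
  congr 1
  ring

/-- Written in terms of cosines, this is the Stewart inequality multiplied by `dist p x`. -/
theorem IsNonnegativelyCurved.comparisonAngle_mono {X : Type*} [MetricSpace X]
    (hX : IsNonnegativelyCurved X) {γ : ℝ → X} {L : ℝ} {p q x : X}
    (h : IsGeodesicSegment γ L p q) (hx : x ≠ p) {t : ℝ} (ht : 0 < t) (htL : t ≤ L) :
    comparisonAngle p q x ≤ comparisonAngle p (γ t) x := by
  have hpt := h.dist_left ⟨ht.le, htL⟩
  have htq := h.dist_right ⟨ht.le, htL⟩
  have hpq := h.dist_endpoints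
  have hL : 0 < L := ht.trans_le htL
  have hb : 0 < dist p x := dist_pos.2 hx.symm
  have hst := hX.stewart (x := x) (y := p) (z := q) (w := γ t) (by rw [hpt, htq, hpq]; ring) hx
    (dist_pos.1 (hpq ▸ hL))
  rw [hpt, htq, hpq, dist_comm x p, dist_comm x q, dist_comm x (γ t)] at hst
  unfold comparisonAngle
  rw [hpt, hpq]
  apply arccos_le_arccos
  rw [div_le_div_iff₀ (by positivity) (by positivity)]
  have := mul_le_mul_of_nonneg_left hst hb.le
  linear_combination 2 * this

theorem isBoundedUnder_le_comparisonAngle {X ι : Type*} [MetricSpace X] (p : X) (F : Filter ι)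
    (f g : ι → X) : F.IsBoundedUnder (· ≤ ·) (fun i => comparisonAngle p (f i) (g i)) :=
  isBoundedUnder_of ⟨π, fun _ => comparisonAngle_le_pi _ _ _⟩

theorem isBoundedUnder_ge_comparisonAngle {X ι : Type*} [MetricSpace X] (p : X) (F : Filter ι)
    (f g : ι → X) : F.IsBoundedUnder (· ≥ ·) (fun i => comparisonAngle p (f i) (g i)) :=
  isBoundedUnder_of ⟨0, fun _ => comparisonAngle_nonneg _ _ _⟩

theorem initialAngle_nonneg {X : Type*} [MetricSpace X] (p : X) (γ η : ℝ → X) :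
    0 ≤ initialAngle p γ η :=
  le_limsup_of_frequently_le (Frequently.of_forall fun _ => comparisonAngle_nonneg _ _ _)
    (isBoundedUnder_le_comparisonAngle _ _ _ _)

theorem initialAngle_le_pi {X : Type*} [MetricSpace X] (p : X) (γ η : ℝ → X) :
    initialAngle p γ η ≤ π :=
  limsup_le_of_le (isBoundedUnder_ge_comparisonAngle _ _ _ _).isCoboundedUnder_le
    (Eventually.of_forall fun _ => comparisonAngle_le_pi _ _ _)

/-- Shrinking either side towards `p` only increases the comparison angle, so the full triangle
bounds the upper limit from below. -/
theorem IsNonnegativelyCurved.comparisonAngle_le_initialAngle {X : Type*} [MetricSpace X]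
    (hX : IsNonnegativelyCurved X) {γ η : ℝ → X} {L M : ℝ} {p q q' : X}
    (hγ : IsGeodesicSegment γ L p q) (hη : IsGeodesicSegment η M p q') (hL : 0 < L) (hM : 0 < M) :
    comparisonAngle p q q' ≤ initialAngle p γ η := by
  refine le_limsup_of_frequently_le (Eventually.frequently ?_)
    (isBoundedUnder_le_comparisonAngle _ _ _ _)
  filter_upwards [prod_mem_prod (Ioc_mem_nhdsGT hL) (Ioc_mem_nhdsGT hM)]
  rintro ⟨t, u⟩ ⟨ht, hu⟩
  have hq' : q' ≠ p := (dist_pos.1 (hη.dist_endpoints ▸ hM)).symm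
  have ht' : γ t ≠ p :=
    (dist_pos.1 ((hγ.dist_left (Ioc_subset_Icc_self ht)).symm ▸ ht.1)).symm
  calc comparisonAngle p q q' ≤ comparisonAngle p (γ t) q' :=
        hX.comparisonAngle_mono hγ hq' ht.1 ht.2
    _ = comparisonAngle p q' (γ t) := comparisonAngle_comm _ _ _
    _ ≤ comparisonAngle p (η u) (γ t) := hX.comparisonAngle_mono hη ht' hu.1 hu.2
    _ = comparisonAngle p (γ t) (η u) := comparisonAngle_comm _ _ _

theorem eventually_lt_cos_comparisonAngle {X : Type*} [MetricSpace X] (p : X) (γ η : ℝ → X) {κ : ℝ}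
    (hκ : κ < cos (initialAngle p γ η)) :
    ∀ᶠ tu in 𝓝[>] (0 : ℝ) ×ˢ 𝓝[>] (0 : ℝ), κ < cos (comparisonAngle p (γ tu.1) (η tu.2)) := by
  set α := initialAngle p γ η with hα
  -- Truncation at `π` keeps `cos` monotone even when the angle itself is `π`.
  have hcont : Tendsto (fun a => cos (min a π)) (𝓝[>] α) (𝓝 (cos α)) := by
    have : ContinuousAt (fun a : ℝ => cos (min a π)) α := by fun_prop
    have h := this.tendsto
    rw [min_eq_left (initialAngle_le_pi p γ η)] at h
    exact h.mono_left nhdsWithin_le_nhds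
  obtain ⟨a, ha, hαa⟩ :=
    ((hcont.eventually (lt_mem_nhds hκ)).and self_mem_nhdsWithin).exists
  have h := eventually_lt_of_limsup_lt (show initialAngle p γ η < a from hαa)
    (isBoundedUnder_le_comparisonAngle _ _ _ _)
  filter_upwards [h] with tu htu
  exact ha.trans_le (cos_le_cos_of_nonneg_of_le_pi (comparisonAngle_nonneg _ _ _) (min_le_right _ _)
    (le_min htu.le (comparisonAngle_le_pi _ _ _)))

/-! ### First variation along a quasi-geodesic -/

/-- Hinge comparison for a geodesic and a quasi-geodesic. -/
theorem IsQuasiGeodesicOn.dist_sq_le {X : Type*} [MetricSpace X] {φ γ : ℝ → X} {I : Set ℝ} {l : ℝ}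
    {p q : X} (hφ : IsQuasiGeodesicOn φ I) (hφ0 : φ 0 = p) (h0 : (0 : ℝ) ∈ I)
    (hγ : IsGeodesicSegment γ l p q) (hl : 0 < l) {T : ℝ} (hT : T ∈ I) (hT0 : 0 ≤ T) :
    dist q (φ T) ^ 2 ≤ T ^ 2 + l ^ 2 - 2 * l * T * cos (initialAngle p γ φ) := by
  have hpq := hγ.dist_endpoints
  have hf0 : dist q (φ 0) = l := by rw [hφ0, dist_comm, hpq]
  rcases hT0.eq_or_lt with rfl | hTpos
  · rw [hf0]
    simp
  suffices H : ∀ κ < cos (initialAngle p γ φ),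
      κ ≤ (T ^ 2 + l ^ 2 - dist q (φ T) ^ 2) / (2 * l * T) by
    have h := le_of_forall_lt_imp_le_of_dense H
    rw [le_div_iff₀ (by positivity)] at h
    linarith
  intro κ hκ
  have hsub : ∀ t ∈ Ioc 0 T, t ∈ I := fun t ht =>
    hφ.concave q |>.1.ordConnected.out h0 hT ⟨ht.1.le, ht.2⟩
  have hspeed : Tendsto (fun t => dist p (φ t) / t) (𝓝[>] 0) (𝓝 1) := by
    have h1 : Tendsto (fun t => dist (φ 0) (φ t) / |0 - t|) (𝓝[>] 0) (𝓝 1) := by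
      refine (hφ.unit_speed 0 h0).mono_left ?_
      rw [← nhdsWithin_Ioc_eq_nhdsGT hTpos]
      exact nhdsWithin_mono _ fun t ht => ⟨hsub t ht, ht.1.ne'⟩
    refine h1.congr' ?_
    filter_upwards [self_mem_nhdsWithin] with t ht
    rw [hφ0, zero_sub, abs_neg, abs_of_pos ht]
  -- Fix a point `γ u` first; the angle bound then holds for all small `t`.
  obtain ⟨u, hu, hu0, hul⟩ :=
    ((eventually_lt_cos_comparisonAngle p γ φ hκ).curry.and (Ioc_mem_nhdsGT hl)).exists
  have hpu := hγ.dist_left ⟨hu0.le, hul⟩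
  have huq := hγ.dist_right ⟨hu0.le, hul⟩
  have hup : γ u ≠ p := (dist_pos.1 (hpu.symm ▸ hu0)).symm
  have hid : Tendsto (fun t : ℝ => t) (𝓝[>] 0) (𝓝 0) := nhdsWithin_le_nhds
  -- `e t` is the first-order bound on the slope of the distance to `q`
  let e : ℝ → ℝ := fun t => (dist p (φ t) / t) ^ 2 * t / (2 * u) - κ * (dist p (φ t) / t)
  have he : Tendsto e (𝓝[>] 0) (𝓝 (-κ)) := by
    have := (((hspeed.pow 2).mul hid).div_const (2 * u)).sub (hspeed.const_mul κ)
    simpa using this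
  -- The expression is `((l + t * e t) ^ 2 - t ^ 2 - l ^ 2) / t`, a bound for the difference
  -- quotient of the concave function at `0`.
  have hlim : Tendsto (fun t => 2 * l * e t + t * e t ^ 2 - t) (𝓝[>] 0) (𝓝 (-(2 * l * κ))) := by
    have := ((he.const_mul (2 * l)).add (hid.mul (he.pow 2))).sub hid
    simpa using this
  have hbound : (dist q (φ T) ^ 2 - T ^ 2 - l ^ 2) / T ≤ -(2 * l * κ) := by
    refine ge_of_tendsto hlim ?_
    filter_upwards [hu, Ioo_mem_nhdsGT hTpos, hspeed.eventually (lt_mem_nhds one_pos)]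
      with t htκ ht hdt
    have ht0 : 0 < t := ht.1
    have hd : 0 < dist p (φ t) := by
      by_contra! hle
      exact absurd hdt (not_lt.2 (div_nonpos_of_nonpos_of_nonneg hle ht0.le))
    have hφp : φ t ≠ p := (dist_pos.1 hd).symm
    have hcos := cos_comparisonAngle_mul hup hφp
    rw [hpu] at hcos
    have h1 : 2 * u * dist p (φ t) * κ ≤
        u ^ 2 + dist p (φ t) ^ 2 - dist (γ u) (φ t) ^ 2 := by
      rw [← hcos]
      exact mul_le_mul_of_nonneg_left htκ.le (by positivity)
    -- Tangent-line bound for the square root: `2 * u * (d - u) ≤ d ^ 2 - u ^ 2`.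
    have h2 : dist (γ u) (φ t) ≤ u + t * e t := by
      have h3 : t * e t = (dist p (φ t) ^ 2 - 2 * u * dist p (φ t) * κ) / (2 * u) := by
        simp only [e]
        field_simp
      rw [h3, ← sub_le_iff_le_add', le_div_iff₀ (by positivity)]
      nlinarith [sq_nonneg (dist (γ u) (φ t) - u)]
    have h4 : dist q (φ t) ≤ l + t * e t := by
      have := dist_triangle q (γ u) (φ t)
      rw [dist_comm q (γ u), huq] at this
      linarith
    have h5 : dist q (φ t) ^ 2 ≤ (l + t * e t) ^ 2 := by gcongr
    -- By concavity the secant slope over `[0, T]` is at most that over `[0, t]`.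
    have h6 := (hφ.concave q).neg.secant_mono h0 (hsub t ⟨ht.1, ht.2.le⟩) hT ht0.ne' hTpos.ne'
      ht.2.le
    simp only [Pi.neg_apply, hf0, sub_zero] at h6
    rw [div_le_div_iff₀ ht0 hTpos] at h6
    rw [div_le_iff₀ hTpos]
    refine le_of_mul_le_mul_left ?_ ht0
    have h7 := mul_le_mul_of_nonneg_left h5 hTpos.le
    linear_combination h6 + h7
  rw [le_div_iff₀ (by positivity)]
  rw [div_le_iff₀ hTpos] at hbound
  linarith

/-! ### Plane trigonometry and the conclusion -/

/-- In a Euclidean triangle with sides `a`, `l` at an angle `A` and angle `B ≤ π - β` between the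
sides `a` and `r`, the vertex opposite to `a` is no higher than the vertex opposite to `l` over the
line making angle `β` with the side `a`. -/
theorem mul_sin_sub_le {a l r A B β : ℝ} (hr : 0 < r) (ha : 0 < a) (hl : 0 < l)
    (hA : 0 ≤ A) (hAπ : A ≤ π) (hB : 0 ≤ B) (hBβ : B + β ≤ π) (hβ : 0 ≤ β)
    (hcosA : 2 * a * l * cos A = a ^ 2 + l ^ 2 - r ^ 2)
    (hcosB : 2 * r * a * cos B = r ^ 2 + a ^ 2 - l ^ 2) :
    l * sin (β - A) ≤ a * sin β := by
  have h1 : r * cos B = a - l * cos A := by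
    apply mul_left_cancel₀ (show 2 * a ≠ 0 by positivity)
    linear_combination hcosA + hcosB
  have h2 : r ^ 2 = a ^ 2 + l ^ 2 - 2 * a * l * cos A := by linarith
  have h3 : r * sin B = l * sin A := by
    have hsA := sin_nonneg_of_nonneg_of_le_pi hA hAπ
    have hsB := sin_nonneg_of_nonneg_of_le_pi hB (by linarith)
    refine (sq_eq_sq₀ (by positivity) (by positivity)).1 ?_
    linear_combination r ^ 2 * sin_sq_add_cos_sq B - l ^ 2 * sin_sq_add_cos_sq A + h2
      - (r * cos B + (a - l * cos A)) * h1
  -- This product is the height difference `a * sin β - l * sin (β - A)`.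
  have h4 : 0 ≤ r * sin (B + β) :=
    mul_nonneg hr.le (sin_nonneg_of_nonneg_of_le_pi (by linarith) hBβ)
  rw [sin_add] at h4
  rw [sin_sub]
  linear_combination h4 + sin β * h1 + cos β * h3

theorem theorem1p11 {X : Type*} [MetricSpace X] [CompleteSpace X]
    (hX : IsNonnegativelyCurved X)
    (p q₁ q₂ : X) (φ₁ φ₂ φ₃ σ : ℝ → X) (I : Set ℝ)
    (l s r α₂ α₃ β : ℝ) (hl : 0 < l) (hs : 0 < s) (hr : 0 < r)
    -- the angles between the initial directions, and their coplanarity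
    (hα₂ : initialAngle p φ₂ φ₁ = α₂)
    (hα₃ : initialAngle p φ₁ φ₃ = α₃)
    (hβ : initialAngle p φ₂ φ₃ = β)
    (hcoplanar : α₂ + α₃ = β)
    (hβ_pos : 0 < β) (hβ_le : β ≤ π / 2)
    -- the two geodesic segments from `p` to `q₁` and `q₂`
    (hφ₁ : IsGeodesicSegment φ₁ l p q₁)
    (hφ₂ : IsGeodesicSegment φ₂ (s / sin β) p q₂)
    -- the quasi-geodesic from `p`
    (hφ₃ : IsQuasiGeodesicOn φ₃ I) (hφ₃_zero : φ₃ 0 = p)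
    (hI_zero : (0 : ℝ) ∈ I) (hI_pos : ∃ T ∈ I, 0 < T) (hI_foot : l * cos α₃ ∈ I)
    -- the geodesic segment from `q₂` to `q₁`, and its angle at `q₂` with the left (backward)
    -- derivative of `φ₂`
    (hσ : IsGeodesicSegment σ r q₂ q₁)
    (hangle : initialAngle q₂ σ (fun t => φ₂ (s / sin β - t)) ≤ π - β) :
    Metric.infDist (σ r) (φ₃ '' I) ≤ dist (σ r) (φ₃ (l * cos α₃)) ∧
      dist (σ r) (φ₃ (l * cos α₃)) ≤ s := by
  have hβ_sin : 0 < sin β := sin_pos_of_pos_of_lt_pi hβ_pos (by linarith [pi_pos])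
  set a := s / sin β with ha
  have ha_pos : 0 < a := div_pos hs hβ_sin
  have hs_eq : s = a * sin β := by rw [ha]; field_simp
  have hpq₁ := hφ₁.dist_endpoints
  have hpq₂ := hφ₂.dist_endpoints
  have hqq := hσ.dist_endpoints
  have hq₁p : q₁ ≠ p := (dist_pos.1 (hpq₁ ▸ hl)).symm
  have hq₂p : q₂ ≠ p := (dist_pos.1 (hpq₂ ▸ ha_pos)).symm
  have hqne : q₁ ≠ q₂ := (dist_pos.1 (hqq ▸ hr)).symm
  have hA := hX.comparisonAngle_le_initialAngle hφ₂ hφ₁ ha_pos hl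
  have hB := (hX.comparisonAngle_le_initialAngle hσ hφ₂.reverse hr ha_pos).trans hangle
  have hcosA := cos_comparisonAngle_mul hq₂p hq₁p
  have hcosB := cos_comparisonAngle_mul hqne hq₂p.symm
  have hA0 := comparisonAngle_nonneg p q₂ q₁
  have hB0 := comparisonAngle_nonneg q₂ q₁ p
  have hAπ := comparisonAngle_le_pi p q₂ q₁
  have hα₃0 : 0 ≤ α₃ := hα₃ ▸ initialAngle_nonneg _ _ _
  rw [hα₂] at hA
  rw [dist_comm q₂ p, dist_comm q₁ p, hpq₁, hpq₂, hqq] at hcosB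
  rw [hpq₁, hpq₂, hqq] at hcosA
  set A := comparisonAngle p q₂ q₁
  set B := comparisonAngle q₂ q₁ p
  have hheight := mul_sin_sub_le hr ha_pos hl hA0 hAπ hB0 (by linarith) hβ_pos.le hcosA hcosB
  have hsin : sin α₃ ≤ sin (β - A) :=
    sin_le_sin_of_le_of_le_pi_div_two (by linarith [pi_pos]) (by linarith) (by linarith)
  have hcos : 0 ≤ cos α₃ := cos_nonneg_of_mem_Icc ⟨by linarith [pi_pos], by linarith⟩
  have hsin0 : 0 ≤ sin α₃ := sin_nonneg_of_nonneg_of_le_pi hα₃0 (by linarith [pi_pos])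
  have hdist := hφ₃.dist_sq_le hφ₃_zero hI_zero hφ₁ hl hI_foot (by positivity)
  rw [hα₃] at hdist
  refine ⟨Metric.infDist_le_dist_of_mem (mem_image_of_mem _ hI_foot), ?_⟩
  rw [hσ.2.2.1]
  calc dist q₁ (φ₃ (l * cos α₃)) ≤ l * sin α₃ := by
        refine le_of_sq_le_sq ?_ (by positivity)
        linear_combination hdist - l ^ 2 * sin_sq_add_cos_sq α₃
    _ ≤ l * sin (β - A) := by gcongr
    _ ≤ s := hs_eq ▸ hheight
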